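/- Let $N\in\mathbb{N}\cup\{\infty\}$, and let $A$ and $B$ be $N\times N$ matrices with integer entries that are row-finite ($\sum_j |A_{i,j}|<\infty$ and $\sum_j|B_{i,j}|<\infty$ for every $i$) and have no identically zero rows. Suppose that $A_{i,j}\ge 0$ for all $i,j$. Let $E$ be the directed graph with vertices $E^0=\{1,\dots,N\}$ (all positive integers if $N=\infty$) and edges $E^1=\{e_{i,j,n}: 0\le n<A_{i,j}\}$, where $s(e_{i,j,n})=i$ and $r(e_{i,j,n})=j$. Let $E^*$ be the set of finite paths $\alpha_1\cdots\alpha_n$, $r(\alpha_i)=s(\alpha_{i+1})$ (vertices are the paths of length $0$), let $E^\infty$ be the set of infinite paths $x_1x_2\cdots$, and for $\beta\in E^*$ let $Z(\beta)\subseteq E^\infty$ be the set of all infinite paths $\beta y$ with $s(y)=r(\beta)$. For $m\in\mathbb{Z}$ and $e=e_{i,j,n}\in E^1$ put $\kappa_m(e)=e_{i,j,l}$ and $\varphi(m,e)=k$, where $(k,l)$ is the unique pair of integers with $mB_{i,j}+n=kA_{i,j}+l$ and $0\le l<A_{i,j}$; extend $\kappa$ to infinite paths by $\kappa_m(e\,y)=\kappa_m(e)\,\kappa_{\varphi(m,e)}(y)$.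 Let $\mathcal{G}_{A,B}$ be the groupoid of classes $[\alpha,m,\beta;x]$ of quadruples with $\alpha,\beta\in E^*$, $r(\alpha)=r(\beta)$, $m\in\mathbb{Z}$, $x\in Z(\beta)$, for the equivalence relation generated by $$(\alpha,m,\beta;x)\sim(\alpha\kappa_m(\gamma),\varphi(m,\gamma),\beta\gamma;x)\qquad\text{whenever } x=\beta\gamma y,\ \gamma\in E^1,\ y\in E^\infty .$$ Its unit space is $E^\infty$, where $x$ with $s(x)=v$ is identified with $[v,0,v;x]$; the source and range of $[\alpha,m,\beta;\beta y]$ are $\beta y$ and $\alpha\kappa_m(y)$; and product and inverse are $[\alpha,m',\beta;\beta\kappa_m(y)]\cdot[\beta,m,\gamma;\gamma y]=[\alpha,m'+m,\gamma;\gamma y]$ and $[\alpha,m,\beta;\beta y]^{-1}=[\beta,-m,\alpha;\alpha\kappa_m(y)]$. Suppose that $|B_{i,j}|<A_{i,j}$ for all $(i,j)$ with $A_{i,j}\neq0$, and that $E$ is acyclic (no path of positive length has equal source and range). Then $\mathcal{G}_{A,B}$ is principal: for every unit $x\in E^\infty$ the isotropy group $\{g\in\mathcal{G}_{A,B}: s(g)=r(g)=x\}$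 is trivial. -/

import Mathlib

open scoped ENNReal

namespace Katsura

/-- The index set `{1, …, N}` for `N ∈ ℕ ∪ {∞}`. -/
abbrev Index (N : ℕ∞) : Type := {i : ℕ // 1 ≤ i ∧ (i : ℕ∞) ≤ N}

variable {V : Type*}

/-- Every row has finite `ℓ¹`-sum. -/
def RowFinite (A : Matrix V V ℤ) : Prop :=
  ∀ i, ∑' j, ((A i j).natAbs : ℝ≥0∞) < ⊤

/-- The set of positions of nonzero entries. -/
def Omega (A : Matrix V V ℤ) : Set (V × V) := {p | A p.1 p.2 ≠ 0}

/-! ### The graph of a matrix -/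

/-- The edges `e_{i,j,n}`, `0 ≤ n < A i j`, of the graph with vertex set `V`; the edge `e_{i,j,n}`
goes from `i` to `j`. -/
@[ext]
structure Edge (A : Matrix V V ℤ) where
  src : V
  tgt : V
  n : ℤ
  nonneg : 0 ≤ n
  lt : n < A src tgt

variable {A : Matrix V V ℤ}

theorem Edge.pos (e : Edge A) : 0 < A e.src e.tgt := e.nonneg.trans_lt e.lt

/-- `IsPathFromTo v l w`: the consecutive edges in `l` are composable and lead from `v` to `w`. -/
def IsPathFromTo : V → List (Edge A) → V → Prop
  | v, [], w => v = w
  | v, e :: l, w => e.src = v ∧ IsPathFromTo e.tgt l w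

/-- Finite paths, including the paths of length zero, which are the vertices. -/
structure FinPath (A : Matrix V V ℤ) where
  src : V
  edges : List (Edge A)
  tgt : V
  isPath : IsPathFromTo src edges tgt

/-- The length `|α|` of a finite path. -/
def FinPath.length (α : FinPath A) : ℕ := α.edges.length

/-- The path of length zero at `v`. -/
def FinPath.vertex (A : Matrix V V ℤ) (v : V) : FinPath A := ⟨v, [], v, rfl⟩

/-- The graph is acyclic: no path of positive length has equal source and range. -/
def IsAcyclic (A : Matrix V V ℤ) : Prop :=
  ∀ α : FinPath A, 0 < α.length → α.src ≠ α.tgt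

/-- Infinite paths `x = x₁ x₂ ⋯`, indexed from `0`. -/
@[ext]
structure InfPath (A : Matrix V V ℤ) where
  edges : Stream' (Edge A)
  chain : ∀ i, (edges.get i).tgt = (edges.get (i + 1)).src

/-- The source of an infinite path. -/
def InfPath.src (x : InfPath A) : V := (x.edges.get 0).src

/-- The infinite path obtained by deleting the first `k` edges. -/
def InfPath.drop (k : ℕ) (x : InfPath A) : InfPath A where
  edges := x.edges.drop k
  chain i := by
    have := x.chain (i + k)
    rw [Stream'.get_drop, Stream'.get_drop]
    convert this using 3 <;> omega

theorem chain_append {l : List (Edge A)} {v w : V} (hl : IsPathFromTo v l w)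
    {y : Stream' (Edge A)} (hy : ∀ i, (y.get i).tgt = (y.get (i + 1)).src)
    (h : (y.get 0).src = w) :
    ((l ++ₛ y).get 0).src = v ∧
      ∀ i, ((l ++ₛ y).get i).tgt = ((l ++ₛ y).get (i + 1)).src := by
  induction l generalizing v with
  | nil => cases hl; exact ⟨h, hy⟩
  | cons e l ih =>
    obtain ⟨h1, h2⟩ := hl
    obtain ⟨h3, h4⟩ := ih h2
    refine ⟨h1, fun i => ?_⟩
    cases i with
    | zero => exact h3.symm
    | succ i => exact h4 i

/-- The concatenation `α y`, where the source of `y` is the range of `α`. -/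
def FinPath.append (α : FinPath A) (y : InfPath A) (h : y.src = α.tgt) : InfPath A where
  edges := α.edges ++ₛ y.edges
  chain := (chain_append α.isPath y.chain h).2

/-- The cylinder set `Z(α)` of infinite paths `α y`. -/
def FinPath.cyl (α : FinPath A) : Set (InfPath A) :=
  {x | ∃ (y : InfPath A) (h : y.src = α.tgt), x = α.append y h}

/-- The path `α e` for an edge `e` starting at the range of `α`. -/
def FinPath.snoc (α : FinPath A) (e : Edge A) (h : e.src = α.tgt) : FinPath A where
  src := α.src
  edges := α.edges ++ [e]
  tgt := e.tgt
  isPath := by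
    have key : ∀ (l : List (Edge A)) (v : V), IsPathFromTo v l α.tgt →
        IsPathFromTo v (l ++ [e]) e.tgt := by
      intro l
      induction l with
      | nil => intro v hv; exact ⟨h.trans hv.symm, rfl⟩
      | cons a l ih => intro v hv; exact ⟨hv.1, ih _ hv.2⟩
    exact key _ _ α.isPath

/-! ### The action `κ` of `ℤ` and the cocycle `φ` -/

variable (B : Matrix V V ℤ)

/-- `κ_m(e_{i,j,n}) = e_{i,j,l}` where `m B_{i,j} + n = k A_{i,j} + l` and `0 ≤ l < A_{i,j}`. -/
def kappa (m : ℤ) (e : Edge A) : Edge A where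
  src := e.src
  tgt := e.tgt
  n := (m * B e.src e.tgt + e.n) % A e.src e.tgt
  nonneg := Int.emod_nonneg _ e.pos.ne'
  lt := Int.emod_lt_of_pos _ e.pos

/-- `φ(m, e_{i,j,n}) = k` where `m B_{i,j} + n = k A_{i,j} + l` and `0 ≤ l < A_{i,j}`. -/
def phi (m : ℤ) (e : Edge A) : ℤ := (m * B e.src e.tgt + e.n) / A e.src e.tgt

/-- `(φ(m, e), index of κ_m(e))` is the unique pair `(k, l)` in the division with remainder. -/
theorem kappa_phi_iff (m : ℤ) (e : Edge A) (k l : ℤ) :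
    (m * B e.src e.tgt + e.n = k * A e.src e.tgt + l ∧ 0 ≤ l ∧ l < A e.src e.tgt) ↔
      phi B m e = k ∧ (kappa B m e).n = l := by
  have := Int.ediv_emod_unique (a := m * B e.src e.tgt + e.n) (r := l) (q := k) e.pos
  simp only [phi, kappa]
  rw [this]
  constructor
  · rintro ⟨h, h1, h2⟩; exact ⟨by rw [h]; ring, h1, h2⟩
  · rintro ⟨h, h1, h2⟩; exact ⟨by rw [← h]; ring, h1, h2⟩

theorem kappa_phi_spec (m : ℤ) (e : Edge A) :
    m * B e.src e.tgt + e.n = phi B m e * A e.src e.tgt + (kappa B m e).n :=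
  ((kappa_phi_iff B m e _ _).2 ⟨rfl, rfl⟩).1

theorem kappa_phi_add (m₁ m₂ : ℤ) (e : Edge A) :
    phi B (m₁ + m₂) e = phi B m₁ (kappa B m₂ e) + phi B m₂ e ∧
      kappa B (m₁ + m₂) e = kappa B m₁ (kappa B m₂ e) := by
  have h1 := kappa_phi_spec B m₂ e
  have h2 := kappa_phi_spec B m₁ (kappa B m₂ e)
  have h3 : (kappa B m₂ e).src = e.src := rfl
  have h4 : (kappa B m₂ e).tgt = e.tgt := rfl
  rw [h3, h4] at h2
  have := (kappa_phi_iff B (m₁ + m₂) e (phi B m₁ (kappa B m₂ e) + phi B m₂ e)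
    (kappa B m₁ (kappa B m₂ e)).n).1
    ⟨by linarith, (kappa B m₁ (kappa B m₂ e)).nonneg, (kappa B m₁ (kappa B m₂ e)).lt⟩
  exact ⟨this.1, Edge.ext rfl rfl this.2⟩

theorem kappa_phi_zero (e : Edge A) : phi B 0 e = 0 ∧ kappa B 0 e = e := by
  have := (kappa_phi_iff B 0 e 0 e.n).1 ⟨by ring, e.nonneg, e.lt⟩
  exact ⟨this.1, Edge.ext rfl rfl this.2⟩

/-- `cocycleSeq B m x i = φ(m, x₁ ⋯ xᵢ)`, where `φ(m, α'α'') = φ(φ(m, α'), α'')`. -/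
def cocycleSeq (m : ℤ) (x : Stream' (Edge A)) : ℕ → ℤ
  | 0 => m
  | i + 1 => phi B (cocycleSeq m x i) (x.get i)

/-- The action extended to infinite paths by `κ_m(α'α'') = κ_m(α') κ_{φ(m, α')}(α'')`: the `i`-th
edge of `κ_m(x)` is the image of the `i`-th edge of `x` under `κ_{φ(m, x₁ ⋯ x_{i-1})}`. -/
def kappaInf (m : ℤ) (x : InfPath A) : InfPath A where
  edges := fun i => kappa B (cocycleSeq B m x.edges i) (x.edges.get i)
  chain := x.chain

theorem kappaInf_get (m : ℤ) (x : InfPath A) (i : ℕ) :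
    (kappaInf B m x).edges.get i = kappa B (cocycleSeq B m x.edges i) (x.edges.get i) := rfl

/-! ### Quadruples and their classes -/

/-- The quadruples `(α, m, β; x)` with `r(α) = r(β)` and `x ∈ Z(β)`. -/
structure Quad (A B : Matrix V V ℤ) where
  α : FinPath A
  m : ℤ
  β : FinPath A
  x : InfPath A
  tgt_eq : α.tgt = β.tgt
  mem : x ∈ β.cyl

variable {B}

theorem FinPath.drop_of_mem {β : FinPath A} {x : InfPath A} (h : x ∈ β.cyl) :
    (x.drop β.length).src = β.tgt ∧ β.edges ++ₛ (x.drop β.length).edges = x.edges := by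
  obtain ⟨y, hy, rfl⟩ := h
  have : ((β.append y hy).drop β.length) = y := by
    ext1
    exact Stream'.drop_append_stream _ _
  rw [this]
  exact ⟨hy, rfl⟩

namespace Quad

/-- The infinite path `y` with `x = β y`. -/
def tail (q : Quad A B) : InfPath A := q.x.drop q.β.length

theorem tail_src (q : Quad A B) : q.tail.src = q.β.tgt := (FinPath.drop_of_mem q.mem).1

/-- The edge `γ` with `x = β γ y`. -/
def next (q : Quad A B) : Edge A := q.tail.edges.get 0

theorem next_src (q : Quad A B) : q.next.src = q.β.tgt := q.tail_src

/-- The quadruple `(α κ_m(γ), φ(m, γ), β γ; x)`, where `γ` is the edge with `x = β γ y`. -/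
def extend (q : Quad A B) : Quad A B where
  α := q.α.snoc (kappa B q.m q.next) (q.next_src.trans q.tgt_eq.symm)
  m := phi B q.m q.next
  β := q.β.snoc q.next q.next_src
  x := q.x
  tgt_eq := rfl
  mem := by
    refine ⟨q.tail.drop 1, (q.tail.chain 0).symm, ?_⟩
    ext1
    have h := (FinPath.drop_of_mem q.mem).2
    change q.x.edges = (q.β.edges ++ [q.next]) ++ₛ q.tail.edges.drop 1
    rw [Stream'.append_append_stream]
    have h2 : [q.next] ++ₛ q.tail.edges.drop 1 = q.tail.edges := by
      change Stream'.cons q.tail.edges.head q.tail.edges.tail = _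
      exact Stream'.eta _
    rw [h2]
    exact h.symm

/-- The relation that generates the equivalence of quadruples. -/
def Step (p q : Quad A B) : Prop := q = p.extend

/-- `α κ_m(y)`, where `x = β y`. -/
def range (q : Quad A B) : InfPath A :=
  q.α.append (kappaInf B q.m q.tail) (q.tail_src.trans q.tgt_eq.symm)

end Quad

/-- The set of classes `[α, m, β; x]` for the equivalence relation generated by `Quad.Step`. -/
def Germ (A B : Matrix V V ℤ) : Type _ := Quot (Quad.Step (A := A) (B := B))

/-- The class `[α, m, β; x]`. -/
def Germ.mk (q : Quad A B) : Germ A B := Quot.mk _ q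

theorem FinPath.ext_of {α β : FinPath A} (h : α.src = β.src) (h' : α.edges = β.edges) :
    α = β := by
  obtain ⟨v, l, w, hp⟩ := α
  obtain ⟨v', l', w', hp'⟩ := β
  simp only at h h'
  subst h h'
  have key : ∀ (l : List (Edge A)) (v : V), IsPathFromTo v l w → IsPathFromTo v l w' → w = w' := by
    intro l
    induction l with
    | nil => intro v h1 h2; exact h1.symm.trans h2
    | cons a l ih => intro v h1 h2; exact ih _ h1.2 h2.2
  cases key _ _ hp hp'
  rfl

theorem FinPath.src_of_mem {α : FinPath A} {x : InfPath A} (h : x ∈ α.cyl) : x.src = α.src := by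
  obtain ⟨y, hy, rfl⟩ := h
  exact (chain_append α.isPath y.chain hy).1

theorem FinPath.eq_of_mem {α β : FinPath A} {x : InfPath A} (hα : x ∈ α.cyl) (hβ : x ∈ β.cyl)
    (h : α.length = β.length) : α = β := by
  refine FinPath.ext_of ((src_of_mem hα).symm.trans (src_of_mem hβ)) ?_
  have h1 := (drop_of_mem hα).2
  have h2 := (drop_of_mem hβ).2
  rw [← h, ← h1] at h2
  exact (Stream'.append_left_injective _ _ _ _ h2 h.symm).symm

theorem FinPath.append_mem (α : FinPath A) (y : InfPath A) (h : y.src = α.tgt) :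
    α.append y h ∈ α.cyl := ⟨y, h, rfl⟩

theorem FinPath.drop_append (α : FinPath A) (y : InfPath A) (h : y.src = α.tgt) :
    (α.append y h).drop α.length = y := by
  ext1
  exact Stream'.drop_append_stream _ _

theorem cocycleSeq_succ (m : ℤ) (x : Stream' (Edge A)) (i : ℕ) :
    cocycleSeq B m x (i + 1) = cocycleSeq B (phi B m (x.get 0)) (x.drop 1) i := by
  induction i with
  | zero => rfl
  | succ i ih => rw [cocycleSeq, ih, cocycleSeq]; rfl

theorem kappaInf_drop (m : ℤ) (x : InfPath A) :
    (kappaInf B m x).drop 1 = kappaInf B (phi B m (x.edges.get 0)) (x.drop 1) := by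
  ext1
  refine Stream'.ext fun i => ?_
  change kappa B (cocycleSeq B m x.edges (i + 1)) (x.edges.get (i + 1)) = _
  rw [cocycleSeq_succ]
  rfl

theorem kappaInf_add (m₁ m₂ : ℤ) (x : InfPath A) :
    kappaInf B (m₁ + m₂) x = kappaInf B m₁ (kappaInf B m₂ x) := by
  have h : ∀ i, cocycleSeq B (m₁ + m₂) x.edges i =
      cocycleSeq B m₁ (kappaInf B m₂ x).edges i + cocycleSeq B m₂ x.edges i := by
    intro i
    induction i with
    | zero => rfl
    | succ i ih =>
      rw [cocycleSeq, ih, (kappa_phi_add B _ _ _).1]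
      rfl
  ext1
  refine Stream'.ext fun i => ?_
  rw [kappaInf_get, h, (kappa_phi_add B _ _ _).2]
  rfl

theorem kappaInf_zero (x : InfPath A) : kappaInf B 0 x = x := by
  have h : ∀ i, cocycleSeq B 0 x.edges i = 0 := by
    intro i
    induction i with
    | zero => rfl
    | succ i ih => rw [cocycleSeq, ih, (kappa_phi_zero B _).1]
  ext1
  refine Stream'.ext fun i => ?_
  rw [kappaInf_get, h, (kappa_phi_zero B _).2]

namespace Quad

theorem ext_of {p q : Quad A B} (h₁ : p.α = q.α) (h₂ : p.m = q.m) (h₃ : p.β = q.β)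
    (h₄ : p.x = q.x) : p = q := by
  cases p; cases q; simp only at h₁ h₂ h₃ h₄; subst h₁ h₂ h₃ h₄; rfl

theorem length_α_extend (q : Quad A B) : q.extend.α.length = q.α.length + 1 := by
  simp [extend, FinPath.snoc, FinPath.length]

theorem length_β_extend (q : Quad A B) : q.extend.β.length = q.β.length + 1 := by
  simp [extend, FinPath.snoc, FinPath.length]

theorem tail_extend (q : Quad A B) : q.extend.tail = q.tail.drop 1 := by
  unfold tail
  rw [length_β_extend]
  ext1
  change Stream'.drop _ q.x.edges = Stream'.drop _ (Stream'.drop _ q.x.edges)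
  rw [Stream'.drop_drop, add_comm]

theorem range_extend (q : Quad A B) : q.extend.range = q.range := by
  ext1
  change (q.α.edges ++ [kappa B q.m q.next]) ++ₛ (kappaInf B q.extend.m q.extend.tail).edges =
    q.α.edges ++ₛ (kappaInf B q.m q.tail).edges
  rw [Stream'.append_append_stream, tail_extend]
  congr 1
  have h : kappaInf B q.extend.m (q.tail.drop 1) = (kappaInf B q.m q.tail).drop 1 :=
    (kappaInf_drop _ _).symm
  rw [h]
  exact Stream'.eta (kappaInf B q.m q.tail).edges

theorem range_mem (q : Quad A B) : q.range ∈ q.α.cyl := FinPath.append_mem _ _ _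

/-- The unit `[v, 0, v; x]`, where `v` is the source of `x`. -/
def unit (B : Matrix V V ℤ) (x : InfPath A) : Quad A B where
  α := FinPath.vertex A x.src
  m := 0
  β := FinPath.vertex A x.src
  x := x
  tgt_eq := rfl
  mem := ⟨x, rfl, rfl⟩

theorem range_unit (x : InfPath A) : (unit B x).range = x := by
  have h : (unit B x).tail = x := rfl
  ext1
  change (kappaInf B 0 (unit B x).tail).edges = _
  rw [h, kappaInf_zero]

/-- The inverse `(β, -m, α; α κ_m(y))`, where `x = β y`. -/
def inv (q : Quad A B) : Quad A B where
  α := q.β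
  m := -q.m
  β := q.α
  x := q.range
  tgt_eq := q.tgt_eq.symm
  mem := q.range_mem

theorem tail_inv (q : Quad A B) : q.inv.tail = kappaInf B q.m q.tail :=
  FinPath.drop_append q.α (kappaInf B q.m q.tail) (q.tail_src.trans q.tgt_eq.symm)

theorem range_inv (q : Quad A B) : q.inv.range = q.x := by
  ext1
  change q.β.edges ++ₛ (kappaInf B (-q.m) q.inv.tail).edges = _
  rw [tail_inv, ← kappaInf_add, neg_add_cancel, kappaInf_zero]
  exact (FinPath.drop_of_mem q.mem).2

theorem extend_inv (q : Quad A B) : q.extend.inv = q.inv.extend := by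
  have hn : q.inv.next = kappa B q.m q.next := by
    unfold next; rw [tail_inv]; rfl
  have h := kappa_phi_add B (-q.m) q.m q.next
  rw [neg_add_cancel, (kappa_phi_zero B q.next).1, (kappa_phi_zero B q.next).2] at h
  refine ext_of (FinPath.ext_of rfl ?_) ?_ (FinPath.ext_of rfl ?_) q.range_extend
  · change q.β.edges ++ [q.next] = q.β.edges ++ [kappa B (-q.m) q.inv.next]
    rw [hn, ← h.2]
  · change - phi B q.m q.next = phi B (-q.m) q.inv.next
    rw [hn]; linarith [h.1]
  · change q.α.edges ++ [kappa B q.m q.next] = q.α.edges ++ [q.inv.next]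
    rw [hn]

/-- The product `(α, m', β; β κ_m(y)) · (β, m, γ; γ y) = (α, m' + m, γ; γ y)`. -/
def mul (p q : Quad A B) (h : p.β = q.α) : Quad A B where
  α := p.α
  m := p.m + q.m
  β := q.β
  x := q.x
  tgt_eq := p.tgt_eq.trans ((congrArg FinPath.tgt h).trans q.tgt_eq)
  mem := q.mem

theorem tail_of_comp {p q : Quad A B} (h : p.β = q.α) (hx : p.x = q.range) :
    p.tail = kappaInf B q.m q.tail := by
  unfold tail
  rw [hx, h]
  exact FinPath.drop_append _ _ _

theorem range_mul {p q : Quad A B} (h : p.β = q.α) (hx : p.x = q.range) :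
    (p.mul q h).range = p.range := by
  ext1
  change p.α.edges ++ₛ (kappaInf B (p.m + q.m) q.tail).edges =
    p.α.edges ++ₛ (kappaInf B p.m p.tail).edges
  rw [tail_of_comp h hx, kappaInf_add]

theorem extend_align {p q : Quad A B} (hx : p.x = q.range)
    (h : p.β.length = q.α.length) : p.β = q.α :=
  FinPath.eq_of_mem (x := p.x) p.mem (hx ▸ q.range_mem) h

theorem extend_mul {p q : Quad A B} (h : p.β = q.α) (hx : p.x = q.range)
    (h' : p.extend.β = q.extend.α) :
    p.extend.mul q.extend h' = (p.mul q h).extend := by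
  have hn : p.next = kappa B q.m q.next := by
    unfold next; rw [tail_of_comp h hx]; rfl
  have hk := kappa_phi_add B p.m q.m q.next
  refine ext_of (FinPath.ext_of rfl ?_) ?_ (FinPath.ext_of rfl rfl) rfl
  · change p.α.edges ++ [kappa B p.m p.next] = p.α.edges ++ [kappa B (p.m + q.m) q.next]
    rw [hn, hk.2]
  · change phi B p.m p.next + phi B q.m q.next = phi B (p.m + q.m) q.next
    rw [hn, hk.1]

/-! Iterated extensions. -/

theorem length_α_iter (q : Quad A B) (k : ℕ) :
    (extend^[k] q).α.length = q.α.length + k := by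
  induction k with
  | zero => rfl
  | succ k ih => rw [Function.iterate_succ_apply', length_α_extend, ih, add_assoc]

theorem length_β_iter (q : Quad A B) (k : ℕ) :
    (extend^[k] q).β.length = q.β.length + k := by
  induction k with
  | zero => rfl
  | succ k ih => rw [Function.iterate_succ_apply', length_β_extend, ih, add_assoc]

theorem range_iter (q : Quad A B) (k : ℕ) : (extend^[k] q).range = q.range := by
  induction k with
  | zero => rfl
  | succ k ih => rw [Function.iterate_succ_apply', range_extend, ih]

theorem x_iter (q : Quad A B) (k : ℕ) : (extend^[k] q).x = q.x := by
  induction k with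
  | zero => rfl
  | succ k ih => rw [Function.iterate_succ_apply', ← ih]; rfl

theorem align_iter {p q : Quad A B} (hx : p.x = q.range) {a b : ℕ}
    (h : p.β.length + a = q.α.length + b) : (extend^[a] p).β = (extend^[b] q).α :=
  extend_align (by rw [x_iter, range_iter, hx]) (by rw [length_β_iter, length_α_iter, h])

end Quad

namespace Germ

theorem mk_extend (q : Quad A B) : mk q.extend = mk q :=
  (Quot.sound (r := Quad.Step) (show Quad.Step q q.extend from rfl)).symm

theorem mk_iter (q : Quad A B) (k : ℕ) : mk (Quad.extend^[k] q) = mk q := by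
  induction k with
  | zero => rfl
  | succ k ih => rw [Function.iterate_succ_apply', mk_extend, ih]

theorem mk_eq_iff {p q : Quad A B} :
    mk p = mk q ↔ ∃ a b, Quad.extend^[a] p = Quad.extend^[b] q := by
  constructor
  · intro h
    replace h := Quot.eqvGen_exact h
    induction h with
    | rel p q h => exact ⟨1, 0, h.symm⟩
    | refl p => exact ⟨0, 0, rfl⟩
    | symm p q _ ih => obtain ⟨a, b, h⟩ := ih; exact ⟨b, a, h.symm⟩
    | trans p q r _ _ ih₁ ih₂ =>
      obtain ⟨a, b, h⟩ := ih₁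
      obtain ⟨c, d, h'⟩ := ih₂
      refine ⟨c + a, b + d, ?_⟩
      rw [Function.iterate_add_apply, h, Function.iterate_add_apply, ← h',
        ← Function.iterate_add_apply, ← Function.iterate_add_apply, add_comm]
  · rintro ⟨a, b, h⟩
    rw [← mk_iter p a, h, mk_iter]

/-- `s([α, m, β; x]) = x`. -/
def source : Germ A B → InfPath A := Quot.lift Quad.x fun p q h => by rw [show q = _ from h]; rfl

/-- `r([α, m, β; x]) = α κ_m(y)`, where `x = β y`. -/
def range : Germ A B → InfPath A :=
  Quot.lift Quad.range fun p q h => by rw [show q = _ from h, Quad.range_extend]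

/-- `[α, m, β; x]⁻¹ = [β, -m, α; α κ_m(y)]`, where `x = β y`. -/
def inv : Germ A B → Germ A B :=
  Quot.lift (fun q => mk q.inv) fun p q h => by
    rw [show q = _ from h, Quad.extend_inv, mk_extend]

/-- The unit `[v, 0, v; x]`. -/
def unit (B : Matrix V V ℤ) (x : InfPath A) : Germ A B := mk (Quad.unit B x)

/-- Composable classes have representatives of the form `(α, m', β; β κ_m(y))` and
`(β, m, γ; γ y)`. -/
theorem exists_align (g h : Germ A B) (hgh : g.source = h.range) :
    ∃ pq : Quad A B × Quad A B, mk pq.1 = g ∧ mk pq.2 = h ∧ pq.1.β = pq.2.α := by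
  induction g using Quot.inductionOn with | _ p
  induction h using Quot.inductionOn with | _ q
  exact ⟨(Quad.extend^[q.α.length] p, Quad.extend^[p.β.length] q), mk_iter _ _, mk_iter _ _,
    Quad.align_iter hgh (add_comm _ _)⟩

/-- The product of composable classes,
`[α, m', β; β κ_m(y)] · [β, m, γ; γ y] = [α, m' + m, γ; γ y]`; it does not depend on the chosen
representatives of this form, by `mul_mk`. -/
noncomputable def mul (g h : Germ A B) (hgh : g.source = h.range) : Germ A B :=
  mk ((exists_align g h hgh).choose.1.mul (exists_align g h hgh).choose.2
    (exists_align g h hgh).choose_spec.2.2)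

theorem mk_mul_iter {p q : Quad A B} (h : p.β = q.α) (hx : p.x = q.range) (k : ℕ)
    (h' : (Quad.extend^[k] p).β = (Quad.extend^[k] q).α) :
    mk ((Quad.extend^[k] p).mul (Quad.extend^[k] q) h') = mk (p.mul q h) := by
  induction k generalizing p q with
  | zero => rfl
  | succ k ih =>
    have hx' : p.extend.x = q.extend.range := hx.trans q.range_extend.symm
    have hl : p.extend.β = q.extend.α :=
      Quad.extend_align hx' (by rw [Quad.length_α_extend, Quad.length_β_extend, h])
    have := ih hl hx' h'
    rw [Quad.extend_mul h hx hl, mk_extend] at this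
    exact this

theorem mk_mul_congr {p q p' q' : Quad A B} (h : p.β = q.α) (hx : p.x = q.range)
    (h' : p'.β = q'.α) (hx' : p'.x = q'.range) (hp : mk p = mk p') (hq : mk q = mk q') :
    mk (p.mul q h) = mk (p'.mul q' h') := by
  obtain ⟨a, b, hab⟩ := mk_eq_iff.1 hp
  obtain ⟨c, d, hcd⟩ := mk_eq_iff.1 hq
  have e1 := congrArg (fun r => r.β.length) hab
  have e2 := congrArg (fun r => r.α.length) hcd
  simp only [Quad.length_α_iter, Quad.length_β_iter] at e1 e2
  have e3 := congrArg FinPath.length h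
  have e4 := congrArg FinPath.length h'
  have e5 : d + a = c + b := by omega
  have hp' : Quad.extend^[c + a] p = Quad.extend^[c + b] p' := by
    rw [Function.iterate_add_apply, hab, ← Function.iterate_add_apply]
  have hq' : Quad.extend^[c + a] q = Quad.extend^[c + b] q' := by
    rw [add_comm, Function.iterate_add_apply, hcd, ← Function.iterate_add_apply, add_comm, e5]
  have l1 : (Quad.extend^[c + a] p).β = (Quad.extend^[c + a] q).α :=
    Quad.align_iter hx (by rw [e3])
  have l2 : (Quad.extend^[c + b] p').β = (Quad.extend^[c + b] q').α :=
    Quad.align_iter hx' (by rw [e4])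
  rw [← mk_mul_iter h hx (c + a) l1, ← mk_mul_iter h' hx' (c + b) l2]
  congr 1
  congr 1

theorem mul_mk (p q : Quad A B) (h : p.β = q.α) (hx : p.x = q.range) :
    mul (mk p) (mk q) hx = mk (p.mul q h) := by
  have hs := (exists_align (mk p) (mk q) hx).choose_spec
  refine mk_mul_congr _ ?_ h hx hs.1 hs.2.1
  have h1 := congrArg source hs.1
  have h2 := congrArg range hs.2.1
  exact h1.trans (hx.trans h2.symm)

/-- Induction on composable pairs. -/
theorem ind₂ {P : (g h : Germ A B) → g.source = h.range → Prop}
    (H : ∀ (p q : Quad A B), p.β = q.α → ∀ hx : p.x = q.range, P (mk p) (mk q) hx)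
    (g h : Germ A B) (hgh : g.source = h.range) : P g h hgh := by
  obtain ⟨⟨p, q⟩, rfl, rfl, h⟩ := exists_align g h hgh
  exact H p q h hgh

theorem source_mul (g h : Germ A B) (hgh : g.source = h.range) :
    (mul g h hgh).source = h.source := by
  induction g, h, hgh using ind₂ with | _ p q h hx
  rw [mul_mk p q h hx]
  rfl

theorem range_mul (g h : Germ A B) (hgh : g.source = h.range) :
    (mul g h hgh).range = g.range := by
  induction g, h, hgh using ind₂ with | _ p q h hx
  rw [mul_mk p q h hx]
  exact Quad.range_mul h hx

theorem source_unit (x : InfPath A) : (unit B x).source = x := rfl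

theorem range_unit (x : InfPath A) : (unit B x).range = x := Quad.range_unit x

theorem source_inv (g : Germ A B) : g.inv.source = g.range := by
  induction g using Quot.inductionOn with | _ p
  rfl

theorem range_inv (g : Germ A B) : g.inv.range = g.source := by
  induction g using Quot.inductionOn with | _ p
  exact Quad.range_inv p

/-- The classes `[β, 0, β; x]` are units. -/
theorem mk_eq_unit (q : Quad A B) (h : q.α = q.β) (hm : q.m = 0) : mk q = unit B q.x := by
  refine mk_eq_iff.2 ⟨0, q.β.length, ?_⟩
  have key : ∀ k, (Quad.extend^[k] (Quad.unit B q.x)).m = 0 ∧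
      (Quad.extend^[k] (Quad.unit B q.x)).α = (Quad.extend^[k] (Quad.unit B q.x)).β := by
    intro k
    induction k with
    | zero => exact ⟨rfl, rfl⟩
    | succ k ih =>
      rw [Function.iterate_succ_apply']
      generalize Quad.extend^[k] (Quad.unit B q.x) = p at ih
      obtain ⟨ih1, ih2⟩ := ih
      have h0 := kappa_phi_zero B p.next
      rw [← ih1] at h0
      refine ⟨h0.1.trans ih1, FinPath.ext_of (show p.α.src = p.β.src by rw [ih2]) ?_⟩
      change p.α.edges ++ [kappa B p.m p.next] = p.β.edges ++ [p.next]
      rw [h0.2, ih2]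
  have hβ : q.β = (Quad.extend^[q.β.length] (Quad.unit B q.x)).β := by
    refine FinPath.eq_of_mem (x := q.x) q.mem ?_ ?_
    · have := (Quad.extend^[q.β.length] (Quad.unit B q.x)).mem
      rwa [Quad.x_iter] at this
    · rw [Quad.length_β_iter]
      simp [Quad.unit, FinPath.vertex, FinPath.length]
  exact Quad.ext_of (h.trans (hβ.trans (key _).2.symm)) (hm.trans (key _).1.symm) hβ
    (Quad.x_iter (Quad.unit B q.x) q.β.length).symm

theorem mul_inv (g : Germ A B) (h : g.source = g.inv.range) :
    mul g g.inv h = unit B g.range := by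
  induction g using Quot.inductionOn with | _ p
  refine (mul_mk p p.inv rfl h).trans (mk_eq_unit _ rfl (add_neg_cancel _))

theorem inv_mul (g : Germ A B) (h : g.inv.source = g.range) :
    mul g.inv g h = unit B g.source := by
  induction g using Quot.inductionOn with | _ p
  exact (mul_mk p.inv p rfl h).trans (mk_eq_unit _ rfl (neg_add_cancel _))

theorem mul_assoc (g h k : Germ A B) (h₁ : g.source = h.range) (h₂ : h.source = k.range)
    (h₃ : (mul g h h₁).source = k.range) (h₄ : g.source = (mul h k h₂).range) :
    mul (mul g h h₁) k h₃ = mul g (mul h k h₂) h₄ := by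
  induction g using Quot.inductionOn with | _ p
  induction h using Quot.inductionOn with | _ q
  induction k using Quot.inductionOn with | _ r
  -- representatives with `p.β = q.α` and `q.β = r.α`
  obtain ⟨p', q', r', ep, eq, er, e1, e2⟩ : ∃ p' q' r' : Quad A B, mk p' = mk p ∧ mk q' = mk q ∧
      mk r' = mk r ∧ p'.β = q'.α ∧ q'.β = r'.α := by
    refine ⟨Quad.extend^[q.α.length + r.α.length] p,
      Quad.extend^[p.β.length + r.α.length] q, Quad.extend^[p.β.length + q.β.length] r,
      mk_iter _ _, mk_iter _ _, mk_iter _ _, Quad.align_iter h₁ (by omega),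
      Quad.align_iter h₂ (by omega)⟩
  change mul (mul (mk p) (mk q) h₁) (mk r) h₃ = mul (mk p) (mul (mk q) (mk r) h₂) h₄
  have x1 : p'.x = q'.range := (congrArg source ep).trans (h₁.trans (congrArg range eq).symm)
  have x2 : q'.x = r'.range := (congrArg source eq).trans (h₂.trans (congrArg range er).symm)
  have m1 : mul (mk p) (mk q) h₁ = mk (p'.mul q' e1) := by
    rw [← mul_mk p' q' e1 x1]; congr 1 <;> exact Eq.symm ‹_›
  have m2 : mul (mk q) (mk r) h₂ = mk (q'.mul r' e2) := by
    rw [← mul_mk q' r' e2 x2]; congr 1 <;> exact Eq.symm ‹_›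
  have l : mul (mul (mk p) (mk q) h₁) (mk r) h₃ = mk ((p'.mul q' e1).mul r' e2) := by
    rw [← mul_mk (p'.mul q' e1) r' e2 x2]; congr 1; exact er.symm
  have r : mul (mk p) (mul (mk q) (mk r) h₂) h₄ = mk (p'.mul (q'.mul r' e2) e1) := by
    rw [← mul_mk p' (q'.mul r' e2) e1 (x1.trans (Quad.range_mul e2 x2).symm)]
    congr 1; exact ep.symm
  rw [l, r]
  exact congrArg mk (Quad.ext_of rfl (add_assoc _ _ _) rfl rfl)

theorem mul_unit (g : Germ A B) (x : InfPath A) (hx : g.source = x)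
    (h : g.source = (unit B x).range) : mul g (unit B x) h = g := by
  subst hx
  induction g using Quot.inductionOn with | _ p
  let u : Quad A B := ⟨p.β, 0, p.β, p.x, rfl, p.mem⟩
  have hu : mk u = unit B p.x := mk_eq_unit u rfl rfl
  have hur : p.x = u.range := h.trans (congrArg range hu).symm
  have : mul (mk p) (unit B p.x) h = mk (p.mul u rfl) := by
    rw [← mul_mk p u rfl hur]; congr 1; exact hu.symm
  exact this.trans (congrArg mk (Quad.ext_of rfl (add_zero _) rfl rfl))

theorem unit_mul (g : Germ A B) (x : InfPath A) (hx : g.range = x)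
    (h : (unit B x).source = g.range) : mul (unit B x) g h = g := by
  subst hx
  induction g using Quot.inductionOn with | _ p
  let u : Quad A B := ⟨p.α, 0, p.α, p.range, rfl, p.range_mem⟩
  have hu : mk u = unit B p.range := mk_eq_unit u rfl rfl
  have : mul (unit B p.range) (mk p) h = mk (u.mul p rfl) := by
    rw [← mul_mk u p rfl rfl]; congr 1; exact hu.symm
  exact this.trans (congrArg mk (Quad.ext_of rfl (zero_add _) rfl rfl))

end Germ

/-! ### The groupoid -/

/-- The Katsura--Exel--Pardo groupoid of `A` and `B`, as a category: its objects are the units,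
that is the infinite paths, and its morphisms are the classes `[α, m, β; x]`. -/
@[ext]
structure KEPGroupoid (A B : Matrix V V ℤ) where
  path : InfPath A

/-- A morphism from `x` to `y` is a class with source `x` and range `y`, and `f ≫ g` is the
product `g · f`. -/
noncomputable instance instGroupoid (A B : Matrix V V ℤ) : CategoryTheory.Groupoid (KEPGroupoid A B) where
  Hom x y := {g : Germ A B // g.source = x.path ∧ g.range = y.path}
  id x := ⟨Germ.unit B x.path, Germ.source_unit _, Germ.range_unit _⟩
  comp f g := ⟨Germ.mul g.1 f.1 (g.2.1.trans f.2.2.symm),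
    (Germ.source_mul _ _ _).trans f.2.1, (Germ.range_mul _ _ _).trans g.2.2⟩
  inv f := ⟨f.1.inv, (Germ.source_inv _).trans f.2.2, (Germ.range_inv _).trans f.2.1⟩
  id_comp {x _} f := Subtype.ext
    (Germ.mul_unit f.1 x.path f.2.1 (f.2.1.trans (Germ.range_unit x.path).symm))
  comp_id {_ y} f := Subtype.ext (Germ.unit_mul f.1 y.path f.2.2 f.2.2.symm)
  assoc f g h := Subtype.ext (Germ.mul_assoc h.1 g.1 f.1 (h.2.1.trans g.2.2.symm)
    (g.2.1.trans f.2.2.symm)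
    ((Germ.source_mul _ _ _).trans (g.2.1.trans f.2.2.symm))
    (h.2.1.trans (g.2.2.symm.trans (Germ.range_mul _ _ _).symm))).symm
  inv_comp f := Subtype.ext
    ((Germ.mul_inv f.1 (Germ.range_inv f.1).symm).trans (congrArg _ f.2.2))
  comp_inv f := Subtype.ext
    ((Germ.inv_mul f.1 (Germ.source_inv f.1)).trans (congrArg _ f.2.1))

/-- A groupoid is principal if all its isotropy groups are trivial. -/
def IsPrincipal (G : Type*) [CategoryTheory.Groupoid G] : Prop :=
  ∀ x : G, Subsingleton (x ⟶ x)

end Katsura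

/-!
If `[α, m, β; x]` has source and range `x`, then `α` and `β` are prefixes of `x` with the same
range; an infinite path in an acyclic graph visits no vertex twice, so `α = β`. Hence `κ_m` fixes
the tail `y` of `x = β y`, and in particular its first edge `e = e_{i,j,n}`. Division with
remainder then reads `m B_{i,j} = φ(m, e) A_{i,j}`, so `|φ(m, e)| < |m|` unless `m = 0`.
Lengthening `α` and `β` edge by edge thus decreases `|m|` until it reaches `0`, where the class is
a unit.
-/

namespace Katsura

variable {V : Type*} {A B : Matrix V V ℤ}

theorem InfPath.src_drop (x : InfPath A) (k : ℕ) : (x.drop k).src = (x.edges.get k).src := by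
  simp only [src, drop, Stream'.get_drop, add_zero]

theorem InfPath.isPathFromTo_take (x : InfPath A) (k : ℕ) :
    IsPathFromTo x.src (x.edges.take k) (x.edges.get k).src := by
  induction k generalizing x with
  | zero => rfl
  | succ k ih =>
    refine ⟨rfl, ?_⟩
    rw [show x.edges.head.tgt = (x.drop 1).src from x.chain 0]
    exact ih (x.drop 1)

theorem IsAcyclic.injective_src_get (hA : IsAcyclic A) (x : InfPath A) :
    Function.Injective fun k => (x.edges.get k).src := by
  refine Function.Injective.of_lt_imp_ne fun i j hij => ?_
  obtain ⟨k, rfl⟩ := Nat.exists_eq_add_of_lt hij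
  have hpath : IsPathFromTo (x.edges.get i).src ((x.drop i).edges.take (k + 1))
      (x.edges.get (i + k + 1)).src := by
    rw [← x.src_drop i, add_assoc, ← Stream'.get_drop]
    exact (x.drop i).isPathFromTo_take (k + 1)
  exact hA ⟨_, _, _, hpath⟩ (Nat.succ_pos _)

theorem IsAcyclic.eq_of_mem_cyl (hA : IsAcyclic A) {α β : FinPath A} {x : InfPath A}
    (hα : x ∈ α.cyl) (hβ : x ∈ β.cyl) (htgt : α.tgt = β.tgt) : α = β := by
  refine FinPath.eq_of_mem hα hβ (hA.injective_src_get x ?_)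
  have src_get {γ : FinPath A} (hγ : x ∈ γ.cyl) : (x.edges.get γ.length).src = γ.tgt :=
    (x.src_drop γ.length).symm.trans (FinPath.drop_of_mem hγ).1
  exact (src_get hα).trans (htgt.trans (src_get hβ).symm)

theorem phi_mul_eq_of_kappa_eq_self {m : ℤ} {e : Edge A} (he : kappa B m e = e) :
    phi B m e * A e.src e.tgt = m * B e.src e.tgt := by
  have hdiv := kappa_phi_spec B m e
  rw [he] at hdiv
  exact (add_right_cancel hdiv).symm

theorem abs_phi_lt_of_kappa_eq_self {m : ℤ} {e : Edge A} (hm : m ≠ 0)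
    (hlt : |B e.src e.tgt| < A e.src e.tgt) (he : kappa B m e = e) : |phi B m e| < |m| := by
  refine lt_of_mul_lt_mul_right ?_ e.pos.le
  calc |phi B m e| * A e.src e.tgt
      = |phi B m e * A e.src e.tgt| := by rw [abs_mul, abs_of_pos e.pos]
    _ = |m| * |B e.src e.tgt| := by rw [phi_mul_eq_of_kappa_eq_self he, abs_mul]
    _ < |m| * A e.src e.tgt := mul_lt_mul_of_pos_left hlt (abs_pos.2 hm)

namespace Quad

theorem kappaInf_tail_eq_self {q : Quad A B} (hαβ : q.α = q.β) (hq : q.range = q.x) :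
    kappaInf B q.m q.tail = q.tail :=
  calc kappaInf B q.m q.tail
      = q.range.drop q.α.length := (FinPath.drop_append q.α _ _).symm
    _ = q.tail := by rw [hq, hαβ, tail]

theorem kappa_next_eq_self {q : Quad A B} (hαβ : q.α = q.β) (hq : q.range = q.x) :
    kappa B q.m q.next = q.next :=
  congrArg (fun y : InfPath A => y.edges.get 0) (kappaInf_tail_eq_self hαβ hq)

theorem extend_α_eq_β {q : Quad A B} (hαβ : q.α = q.β) (hq : q.range = q.x) :
    q.extend.α = q.extend.β := by
  refine FinPath.ext_of (show q.α.src = q.β.src by rw [hαβ]) ?_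
  change q.α.edges ++ [kappa B q.m q.next] = q.β.edges ++ [q.next]
  rw [hαβ, kappa_next_eq_self hαβ hq]

end Quad

namespace Germ

theorem mk_eq_unit_of_α_eq_β_of_range_eq (hlt : ∀ i j, 0 < A i j → |B i j| < A i j) {q : Quad A B}
    (hαβ : q.α = q.β) (hq : q.range = q.x) : mk q = unit B q.x := by
  induction hn : q.m.natAbs using Nat.strong_induction_on generalizing q with | _ n ih
  subst hn
  by_cases hm : q.m = 0
  · exact mk_eq_unit q hαβ hm
  · have hdecr : q.extend.m.natAbs < q.m.natAbs := by
      zify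
      exact abs_phi_lt_of_kappa_eq_self hm (hlt _ _ q.next.pos) (Quad.kappa_next_eq_self hαβ hq)
    calc mk q = mk q.extend := (mk_extend q).symm
      _ = unit B q.x :=
        ih _ hdecr (Quad.extend_α_eq_β hαβ hq) (q.range_extend.trans hq) rfl

theorem eq_unit_of_source_eq_of_range_eq (hA : IsAcyclic A)
    (hlt : ∀ i j, 0 < A i j → |B i j| < A i j) {g : Germ A B} {x : InfPath A}
    (hsource : g.source = x) (hrange : g.range = x) : g = unit B x := by
  subst hsource
  induction g using Quot.inductionOn with | _ q
  have hq : q.range = q.x := hrange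
  exact mk_eq_unit_of_α_eq_β_of_range_eq hlt
    (hA.eq_of_mem_cyl (hq ▸ q.range_mem) q.mem q.tgt_eq) hq

end Germ

end Katsura

theorem mainTheorem10_general {V : Type*} (A B : Matrix V V ℤ)
    (hlt : ∀ i j, 0 < A i j → |B i j| < A i j) (hacyclic : Katsura.IsAcyclic A) :
    Katsura.IsPrincipal (Katsura.KEPGroupoid A B) := by
  intro x
  have eq_unit (f : x ⟶ x) : f.1 = Katsura.Germ.unit B x.path :=
    Katsura.Germ.eq_unit_of_source_eq_of_range_eq hacyclic hlt f.2.1 f.2.2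
  exact ⟨fun f g => Subtype.ext ((eq_unit f).trans (eq_unit g).symm)⟩

theorem mainTheorem10 (N : ℕ∞)
    (A B : Matrix (Katsura.Index N) (Katsura.Index N) ℤ)
    (hA : Katsura.RowFinite A) (hB : Katsura.RowFinite B)
    (hA0 : ∀ i, ∃ j, A i j ≠ 0) (hB0 : ∀ i, ∃ j, B i j ≠ 0)
    (hnonneg : ∀ i j, 0 ≤ A i j)
    (hlt : ∀ i j, (i, j) ∈ Katsura.Omega A → |B i j| < A i j)
    (hacyclic : Katsura.IsAcyclic A) :
    Katsura.IsPrincipal (Katsura.KEPGroupoid A B) :=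
  mainTheorem10_general A B (fun i j hij => hlt i j hij.ne') hacyclic
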